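/- Let $\mathfrak R=\mathbb Z_4+v\mathbb Z_4$ with $v^2=v$, and let $n$ be an odd positive integer. For $A\in\{\mathbb Z_4,\mathfrak R\}$ identify a word $(c_0,\dots,c_{n-1})\in A^n$ with the class of $c_0+c_1x+\dots+c_{n-1}x^{n-1}$ in $A[x]/\langle x^n-1\rangle$; for polynomials $f_1,\dots,f_k\in A[x]$ let $\langle f_1,\dots,f_k\rangle$ denote the cyclic code of length $n$ over $A$ corresponding to the ideal of $A[x]/\langle x^n-1\rangle$ generated by their classes. For a linear code $C\subseteq\mathfrak R^n$ let $C^{\perp}=\{h\in\mathfrak R^n : \sum_i h_ik_i=0 \text{ for all } k\in C\}$ and $\mathrm{Hull}(C)=C\cap C^{\perp}$. For $f\in\mathbb Z_4[x]$ with unit constant term put $f^*(x)=f(0)^{-1}x^{\deg f}f(1/x)$. **Theorem.** For $i=1,2$ let $p_i,q_i,r_i\in\mathbb Z_4[x]$ be monic polynomials with $p_iq_ir_i=x^n-1$, let $C_i=\langle p_iq_i,\,2p_i\rangle$ over $\mathbb Z_4$, and let $C=vC_1\oplus(1-v)C_2$ be the corresponding cyclic code of length $n$ over $\mathfrak R$.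 Then the following least common multiples and greatest common divisors exist in $\mathbb Z_4[x]$ (all taken monic, in the sense of divisibility in $\mathbb Z_4[x]$), and $$\mathrm{Hull}(C)=\big\langle v\,\mathrm{lcm}(p_1q_1,r_1^*q_1^*),\ 2v\,\mathrm{lcm}(p_1,r_1^*),\ (1-v)\,\mathrm{lcm}(p_2q_2,r_2^*q_2^*),\ 2(1-v)\,\mathrm{lcm}(p_2,r_2^*)\big\rangle .$$ Moreover, with $R_i=\gcd(r_i,p_i^*)$, the product $R_i\cdot\mathrm{lcm}(p_i,r_i^*)$ divides $x^n-1$, and with $$Q_i=\frac{x^n-1}{R_i\cdot\mathrm{lcm}(p_i,r_i^*)}\qquad(i=1,2)$$ the code $\mathrm{Hull}(C)$ is of type $4^{\deg R_1+\deg R_2}\,2^{\deg Q_1+\deg Q_2}$, i.e. as an abelian group it is isomorphic to $\mathbb Z_4^{\deg R_1+\deg R_2}\times\mathbb Z_2^{\deg Q_1+\deg Q_2}$ (so $|\mathrm{Hull}(C)|=4^{\deg R_1+\deg R_2}2^{\deg Q_1+\deg Q_2}$). -/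

import Mathlib

open Polynomial

/-- The ring `ℤ₄ + vℤ₄` with `v² = v`: pairs `a + b v` with `a b : ZMod 4` and
`v * v = 0 + 1 * v`. -/
abbrev Z4v : Type := QuadraticAlgebra (ZMod 4) 0 1

/-- The element `v` of `ℤ₄ + vℤ₄`. -/
def Z4v.v : Z4v := ⟨0, 1⟩

theorem Z4v.v_mul_v : Z4v.v * Z4v.v = Z4v.v := by
  ext <;> simp [Z4v.v]

theorem Z4v.eq_add_mul_v (z : Z4v) :
    z = algebraMap (ZMod 4) Z4v z.re + algebraMap (ZMod 4) Z4v z.im * Z4v.v := by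
  ext <;> simp [Z4v.v, QuadraticAlgebra.algebraMap_eq]

/-- The dual `{h | h · k = 0 for all k ∈ C}` of a linear code, for the Euclidean inner product. -/
def dualCode {A : Type*} [CommRing A] {n : ℕ} (C : Submodule A (Fin n → A)) :
    Submodule A (Fin n → A) where
  carrier := {h | ∀ k ∈ C, ∑ i, h i * k i = 0}
  zero_mem' := by intro k _; simp
  add_mem' := by
    intro a b ha hb k hk
    simp only [Pi.add_apply, add_mul, Finset.sum_add_distrib]
    rw [ha k hk, hb k hk, add_zero]
  smul_mem' := by
    intro c a ha k hk
    simp only [Pi.smul_apply, smul_eq_mul, mul_assoc, ← Finset.mul_sum]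
    rw [ha k hk, mul_zero]

/-- The hull `C ∩ C^⊥`. -/
def hullCode {A : Type*} [CommRing A] {n : ℕ} (C : Submodule A (Fin n → A)) :
    Submodule A (Fin n → A) := C ⊓ dualCode C

/-- The quotient ring `A[x] / ⟨x^n - 1⟩`. -/
abbrev CycRing (A : Type*) [CommRing A] (n : ℕ) : Type _ :=
  A[X] ⧸ Ideal.span {(X ^ n - 1 : A[X])}

/-- The identification of `(c₀, …, c_{n-1})` with the class of `c₀ + c₁ x + ⋯ + c_{n-1} x^{n-1}`. -/
noncomputable def wordPoly (A : Type*) [CommRing A] (n : ℕ) :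
    (Fin n → A) →ₗ[A] CycRing A n :=
  (Ideal.Quotient.mkₐ A (Ideal.span {(X ^ n - 1 : A[X])})).toLinearMap ∘ₗ
    ∑ i : Fin n, (monomial (i : ℕ)).comp (LinearMap.proj i)

theorem wordPoly_apply (A : Type*) [CommRing A] (n : ℕ) (c : Fin n → A) :
    wordPoly A n c = Ideal.Quotient.mk _ (∑ i : Fin n, monomial (i : ℕ) (c i)) := by
  simp [wordPoly]

/-- The cyclic code of length `n` over `A` generated by a set `S` of polynomials: the words whose
polynomial lies in the ideal of `A[x] / ⟨x^n - 1⟩` generated by the classes of the elements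
of `S`. -/
noncomputable def genCode {A : Type*} [CommRing A] (n : ℕ) (S : Set A[X]) :
    Submodule A (Fin n → A) :=
  ((Ideal.span ((Ideal.Quotient.mk (Ideal.span {(X ^ n - 1 : A[X])})) '' S) :
    Ideal (CycRing A n)).restrictScalars A).comap (wordPoly A n)

/-- The code `v C₁ ⊕ (1 - v) C₂` over `ℤ₄ + vℤ₄` built from two codes over `ℤ₄`. -/
def vSum {n : ℕ} (C₁ C₂ : Submodule (ZMod 4) (Fin n → ZMod 4)) :
    Submodule Z4v (Fin n → Z4v) where
  carrier := {c | ∃ a ∈ C₁, ∃ b ∈ C₂, ∀ i,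
    c i = Z4v.v * algebraMap (ZMod 4) Z4v (a i) + (1 - Z4v.v) * algebraMap (ZMod 4) Z4v (b i)}
  zero_mem' := ⟨0, C₁.zero_mem, 0, C₂.zero_mem, by simp⟩
  add_mem' := by
    rintro c d ⟨a, ha, b, hb, h⟩ ⟨a', ha', b', hb', h'⟩
    refine ⟨a + a', C₁.add_mem ha ha', b + b', C₂.add_mem hb hb', fun i => ?_⟩
    simp only [Pi.add_apply, h, h', map_add]
    ring
  smul_mem' := by
    rintro z c ⟨a, ha, b, hb, h⟩
    refine ⟨(z.re + z.im) • a, C₁.smul_mem _ ha, z.re • b, C₂.smul_mem _ hb, fun i => ?_⟩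
    have hv := Z4v.v_mul_v
    simp only [Pi.smul_apply, smul_eq_mul, h, map_mul, map_add]
    conv_lhs => rw [Z4v.eq_add_mul_v z]
    linear_combination (algebraMap (ZMod 4) Z4v z.im * algebraMap (ZMod 4) Z4v (a i)
      - algebraMap (ZMod 4) Z4v z.im * algebraMap (ZMod 4) Z4v (b i)) * hv

/-- The (monic) reciprocal polynomial `f*(x) = f(0)⁻¹ x^{deg f} f(1/x)` over `ℤ₄`, for `f` whose
constant coefficient is a unit. -/
noncomputable def recip (f : (ZMod 4)[X]) : (ZMod 4)[X] := C ((f.coeff 0)⁻¹) * f.reverse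

/-- `d` is the monic greatest common divisor of `f` and `g`. -/
def IsMonicGcd {A : Type*} [CommRing A] (f g d : A[X]) : Prop :=
  d.Monic ∧ d ∣ f ∧ d ∣ g ∧ ∀ e : A[X], e ∣ f → e ∣ g → e ∣ d

/-- `m` is the monic least common multiple of `f` and `g`. -/
def IsMonicLcm {A : Type*} [CommRing A] (f g m : A[X]) : Prop :=
  m.Monic ∧ f ∣ m ∧ g ∣ m ∧ ∀ k : A[X], f ∣ k → g ∣ k → m ∣ k

theorem monic_eq_of_dvd_of_dvd {A : Type*} [CommRing A] {f g : A[X]} (hf : f.Monic)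
    (hg : g.Monic) (h : f ∣ g) (h' : g ∣ f) : f = g := by
  obtain ⟨c, rfl⟩ := h
  obtain ⟨d, hd⟩ := h'
  have hcd : c * d = 1 := by
    apply hf.isRegular.left
    simp only
    rw [mul_one, ← mul_assoc]
    exact hd.symm
  exact eq_of_monic_of_associated hf hg ⟨⟨c, d, hcd, by rw [mul_comm]; exact hcd⟩, rfl⟩

/-- There is at most one monic greatest common divisor. -/
theorem IsMonicGcd.unique {A : Type*} [CommRing A] {f g d d' : A[X]} (h : IsMonicGcd f g d)
    (h' : IsMonicGcd f g d') : d = d' :=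
  monic_eq_of_dvd_of_dvd h.1 h'.1 (h'.2.2.2 d h.2.1 h.2.2.1) (h.2.2.2 d' h'.2.1 h'.2.2.1)

/-- There is at most one monic least common multiple. -/
theorem IsMonicLcm.unique {A : Type*} [CommRing A] {f g m m' : A[X]} (h : IsMonicLcm f g m)
    (h' : IsMonicLcm f g m') : m = m' :=
  monic_eq_of_dvd_of_dvd h.1 h'.1 (h.2.2.2 m' h'.2.1 h'.2.2.1) (h'.2.2.2 m h.2.1 h.2.2.1)

/-- A code is of type `4^a 2^b` if, as an abelian group, it is isomorphic to `ℤ₄^a × ℤ₂^b`. -/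
def HasType {A : Type*} [CommRing A] {n : ℕ} (C : Submodule A (Fin n → A)) (a b : ℕ) : Prop :=
  Nonempty (C ≃+ ((Fin a → ZMod 4) × (Fin b → ZMod 2)))

/-- A code of type `4^a 2^b` has `4^a 2^b` words. -/
theorem HasType.card {A : Type*} [CommRing A] {n : ℕ} {C : Submodule A (Fin n → A)} {a b : ℕ}
    (h : HasType C a b) : Nat.card C = 4 ^ a * 2 ^ b := by
  obtain ⟨e⟩ := h
  rw [Nat.card_congr e.toEquiv]
  simp

/-! The idempotent `v` splits everything: duals, hulls and types of `v C₁ ⊕ (1 - v) C₂` are computed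
componentwise (`hullCode_vSum`, `HasType.vSum`, `genCode_eq_vSum`), so the work is over ℤ₄.

There, f lies in (pq, 2p) exactly when p divides f and pq divides f modulo 2
(`exists_eq_iff_dvd_and_redTwo_dvd`). Two such ideals are therefore intersected by taking lcms,
provided monic lcms exist over ℤ₄ and remain lcms modulo 2. This is where odd n enters: x^n - 1 is
separable modulo 2, so complementary factors are coprime, and Bézout identities lift because 2 is
nilpotent (`exists_isMonicLcm`).

The inner product of h and k is the constant coefficient of h(1/x)k(x). Hence the dual of an ideal
is its annihilator transported by x ↦ 1/x, which makes the dual of ⟨pq, 2p⟩ a code of the same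
shape, with r*, q*, p* in place of p, q, r (`dualCode_genCode`). The hull is then ⟨PQ, 2P⟩ with PQR
= x^n - 1, and division with remainder gives unique coordinates on it: deg R in ℤ₄ and deg Q in ℤ₂
(`hasType_genCode`). -/

instance : Nontrivial (ZMod 4) := ⟨0, 1, by decide⟩

/-! ### Reduction modulo 2 and lifting -/

/-- Reduction of polynomials over `ℤ₄` modulo `2`. -/
noncomputable def redTwo : (ZMod 4)[X] →+* (ZMod 2)[X] :=
  mapRingHom (ZMod.castHom (by norm_num : 2 ∣ 4) (ZMod 2))

theorem redTwo_coeff (f : (ZMod 4)[X]) (k : ℕ) :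
    (redTwo f).coeff k = ZMod.castHom (by norm_num : 2 ∣ 4) (ZMod 2) (f.coeff k) := by
  simp [redTwo, coeff_map]

theorem redTwo_surjective : Function.Surjective redTwo :=
  map_surjective _ (ZMod.castHom_surjective _)

theorem two_mul_coeff (f : (ZMod 4)[X]) (k : ℕ) : (2 * f).coeff k = 2 * f.coeff k := by
  rw [show (2 : (ZMod 4)[X]) = C 2 from rfl, coeff_C_mul]

theorem two_mul_eq_zero_iff (f : (ZMod 4)[X]) : 2 * f = 0 ↔ redTwo f = 0 := by
  have key : ∀ a : ZMod 4, 2 * a = 0 ↔ ZMod.castHom (by norm_num : 2 ∣ 4) (ZMod 2) a = 0 := by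
    decide
  simp only [Polynomial.ext_iff, two_mul_coeff, redTwo_coeff, coeff_zero, key]

theorem redTwo_two : redTwo 2 = 0 := by
  rw [map_ofNat]; exact CharTwo.two_eq_zero

theorem redTwo_eq_zero_iff (f : (ZMod 4)[X]) : redTwo f = 0 ↔ ∃ g, f = 2 * g := by
  constructor
  · intro h
    have key : ∀ a : ZMod 4, ZMod.castHom (by norm_num : 2 ∣ 4) (ZMod 2) a = 0 →
        a = 2 * (if a = 0 then 0 else 1) := by decide
    refine ⟨∑ k ∈ f.support, monomial k 1, ?_⟩
    ext k
    have hk := key (f.coeff k) (by rw [← redTwo_coeff, h, coeff_zero])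
    rw [two_mul_coeff]
    simp only [finsetSum_coeff, coeff_monomial, Finset.sum_ite_eq', mem_support_iff]
    rw [ite_not]
    exact hk
  · rintro ⟨g, rfl⟩
    rw [map_mul, redTwo_two, zero_mul]

theorem redTwo_eq_iff (f g : (ZMod 4)[X]) : redTwo f = redTwo g ↔ ∃ k, f = g + 2 * k := by
  rw [← sub_eq_zero, ← map_sub, redTwo_eq_zero_iff]
  simp only [sub_eq_iff_eq_add, add_comm]

theorem two_mul_congr {f g : (ZMod 4)[X]} (h : redTwo f = redTwo g) : 2 * f = 2 * g := by
  rw [← sub_eq_zero, ← mul_sub, two_mul_eq_zero_iff, map_sub, h, sub_self]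

theorem four_eq_zero_poly : (4 : (ZMod 4)[X]) = 0 := by
  have : (4 : (ZMod 4)[X]) = C 4 := rfl
  rw [this, show (4 : ZMod 4) = 0 from rfl, C_0]

theorem redTwo_monic {f : (ZMod 4)[X]} (hf : f.Monic) : (redTwo f).Monic := hf.map _

theorem redTwo_degree {f : (ZMod 4)[X]} (hf : f.Monic) : (redTwo f).degree = f.degree :=
  hf.degree_map _

theorem redTwo_dvd_iff {f g : (ZMod 4)[X]} :
    redTwo f ∣ redTwo g ↔ ∃ u v, g = u * f + v * 2 := by
  constructor
  · rintro ⟨w, hw⟩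
    obtain ⟨w, rfl⟩ := redTwo_surjective w
    rw [← map_mul] at hw
    obtain ⟨k, rfl⟩ := (redTwo_eq_iff _ _).1 hw
    exact ⟨w, k, by ring⟩
  · rintro ⟨u, v, rfl⟩
    simp [redTwo_two]

/-- Coprimality lifts along reduction modulo `2`. -/
theorem isCoprime_of_redTwo {a b : (ZMod 4)[X]} (h : IsCoprime (redTwo a) (redTwo b)) :
    IsCoprime a b := by
  obtain ⟨u, w, h⟩ := h
  obtain ⟨u, rfl⟩ := redTwo_surjective u
  obtain ⟨w, rfl⟩ := redTwo_surjective w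
  rw [← map_mul, ← map_mul, ← map_add, ← map_one redTwo] at h
  obtain ⟨k, hk⟩ := (redTwo_eq_iff _ _).1 h
  -- The lifted combination equals 1 + 2k, which is its own inverse: (1 + 2k)² = 1 + 4(k + k²) = 1.
  refine ⟨(1 + 2 * k) * u, (1 + 2 * k) * w, ?_⟩
  linear_combination (1 + 2 * k) * hk + (k + k ^ 2) * four_eq_zero_poly

/-- For odd n the derivative n x^(n-1) is nonzero modulo 2, so x^n - 1 is separable there and its
complementary factors are coprime; this then lifts. -/
theorem isCoprime_of_mul_eq {n : ℕ} (hn : Odd n) {a b : (ZMod 4)[X]}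
    (h : a * b = X ^ n - 1) : IsCoprime a b := by
  apply isCoprime_of_redTwo
  have hs : (X ^ n - 1 : (ZMod 2)[X]).Separable := by
    rw [X_pow_sub_one_separable_iff]
    intro h0
    exact (Nat.not_even_iff_odd.2 hn) ((ZMod.natCast_eq_zero_iff_even).1 h0)
  have : redTwo a * redTwo b = X ^ n - 1 := by
    rw [← map_mul, h]; simp [redTwo]
  rw [← this] at hs
  exact hs.isCoprime

/-- A polynomial over `ℤ₄` that is nonzero modulo `2` has a monic multiple with the same
reduction. -/
theorem exists_monic_mul_redTwo_eq {g : (ZMod 4)[X]} (hg : redTwo g ≠ 0) :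
    ∃ w, (w * g).Monic ∧ redTwo (w * g) = redTwo g := by
  have hmon : ∀ f : (ZMod 2)[X], f ≠ 0 → f.Monic := by
    intro f hf
    have key : ∀ a : ZMod 2, a ≠ 0 → a = 1 := by decide
    exact key _ (leadingCoeff_ne_zero.2 hf)
  have hm := hmon _ hg
  obtain ⟨g₀, hg₀, hdeg, hg₀m⟩ := lifts_and_natDegree_eq_and_monic
    (f := ZMod.castHom (by norm_num : 2 ∣ 4) (ZMod 2)) (p := redTwo g)
    ((mem_lifts _).2 ⟨g, rfl⟩) hm
  have hg₀' : redTwo g₀ = redTwo g := hg₀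
  obtain ⟨h, hh⟩ := (redTwo_eq_iff _ _).1 hg₀'.symm
  have hdiv := modByMonic_add_div h g₀
  have hlt : (2 * (h %ₘ g₀)).degree < g₀.degree := by
    have := degree_modByMonic_lt h hg₀m
    refine lt_of_le_of_lt ?_ this
    rw [← C_ofNat, ← smul_eq_C_mul]
    exact degree_smul_le _ _
  -- With g = g₀ + 2h and 2g = 2g₀, the factor removes the multiple of g₀ from h. What is left of
  -- the even part has degree below that of g₀, so the leading term of g₀ survives.
  have hkey : (1 - 2 * (h /ₘ g₀)) * g = g₀ + 2 * (h %ₘ g₀) := by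
    have h1 : 2 * g = 2 * g₀ := two_mul_congr hg₀'.symm
    linear_combination hh - (h /ₘ g₀) * h1 - 2 * hdiv
  refine ⟨1 - 2 * (h /ₘ g₀), ?_, ?_⟩
  · rw [hkey]
    exact hg₀m.add_of_left hlt
  · simp [redTwo_two]

theorem Monic.eq_zero_of_mul_eq_zero {A : Type*} [CommRing A] {f g : A[X]} (hf : f.Monic)
    (h : f * g = 0) : g = 0 := hf.isRegular.left (by simpa using h)

theorem eq_zero_of_monic_dvd {A : Type*} [CommRing A] {f g : A[X]} (hf : f.Monic)
    (h : f ∣ g) (hd : g.degree < f.degree) : g = 0 := by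
  by_contra h0
  exact hf.not_dvd_of_degree_lt h0 hd h

/-! ### Monic gcds and lcms over ℤ₄ -/

/-- If a monic `b` divides a product `a * a'` of coprime monic factors, then `(b, a')` is generated
by a monic polynomial. -/
theorem exists_monic_gcd {a a' b : (ZMod 4)[X]} (hb : b.Monic)
    (hco : IsCoprime a a') (hdvd : b ∣ a * a') :
    ∃ c, c.Monic ∧ c ∣ b ∧ c ∣ a' ∧ ∃ u w, c = u * b + w * a' := by
  obtain ⟨b', hb'⟩ := hdvd
  obtain ⟨α, α', hα⟩ := hco
  -- Saturation of I = (b, a'): if 2s is in I, then s is in I modulo 2. Multiplying by a turns 2s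
  -- into a multiple of the monic b with even cofactor 2z, so as ≡ bz modulo 2, and the Bézout
  -- identity for a, a' recovers s.
  have hsat : ∀ s u w, 2 * s = u * b + w * a' → ∃ u' w', redTwo s = redTwo (u' * b + w' * a') := by
    intro s u w h
    have h1 : 2 * (a * s) = b * (u * a + w * b') := by
      linear_combination a * h + w * hb'
    have h2 : redTwo (u * a + w * b') = 0 := by
      have := congrArg redTwo h1
      rw [map_mul, redTwo_two, zero_mul, map_mul] at this
      exact Monic.eq_zero_of_mul_eq_zero (redTwo_monic hb) this.symm
    obtain ⟨z, hz⟩ := (redTwo_eq_zero_iff _).1 h2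
    rw [hz] at h1
    have h3 : redTwo (a * s) = redTwo (b * z) := by
      rw [← sub_eq_zero, ← map_sub, ← two_mul_eq_zero_iff]
      linear_combination h1
    refine ⟨α * z, α' * s, ?_⟩
    have h4 : s = α * (a * s) + (α' * s) * a' := by linear_combination (-s) * hα
    simp only [map_add, map_mul] at h3 ⊢
    have h5 : redTwo s = redTwo α * (redTwo a * redTwo s) + redTwo α' * redTwo s * redTwo a' := by
      simpa using congrArg redTwo h4
    rw [h3] at h5
    linear_combination h5
  have hd1 := EuclideanDomain.gcd_dvd_left (redTwo b) (redTwo a')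
  have hd2 := EuclideanDomain.gcd_dvd_right (redTwo b) (redTwo a')
  have hgcd := EuclideanDomain.gcd_eq_gcd_ab (redTwo b) (redTwo a')
  obtain ⟨u₀, hu₀⟩ := redTwo_surjective (EuclideanDomain.gcdA (redTwo b) (redTwo a'))
  obtain ⟨w₀, hw₀⟩ := redTwo_surjective (EuclideanDomain.gcdB (redTwo b) (redTwo a'))
  have hg : EuclideanDomain.gcd (redTwo b) (redTwo a') = redTwo (u₀ * b + w₀ * a') := by
    rw [hgcd, ← hu₀, ← hw₀]; simp only [map_add, map_mul]; ring
  have hne : redTwo (u₀ * b + w₀ * a') ≠ 0 := by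
    rw [← hg]
    intro h0
    rw [h0] at hd1
    exact (redTwo_monic hb).ne_zero (zero_dvd_iff.1 hd1)
  obtain ⟨m, hcm, hcr⟩ := exists_monic_mul_redTwo_eq hne
  rw [hg] at hd1 hd2
  rw [← hcr] at hd1 hd2
  have hcI : m * (u₀ * b + w₀ * a') = (m * u₀) * b + (m * w₀) * a' := by ring
  generalize m * (u₀ * b + w₀ * a') = c at *
  -- The remainder of f modulo c lies in I and vanishes modulo 2 by degree, so it is 2s. By
  -- saturation c divides s modulo 2, hence c divides 2s, and the degree bound forces the remainder
  -- to be 0.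
  have hdiv : ∀ f u w, f = u * b + w * a' → c ∣ f := by
    intro f u w hf
    have hmd := modByMonic_add_div f c
    have hlt := degree_modByMonic_lt f hcm
    set r := f %ₘ c
    set k := f /ₘ c
    have hlin : ∀ x y, redTwo c ∣ redTwo (x * b + y * a') := by
      intro x y
      rw [map_add, map_mul, map_mul]
      exact dvd_add (hd1.mul_left _) (hd2.mul_left _)
    have hr0 : redTwo r = 0 := by
      refine eq_zero_of_monic_dvd (redTwo_monic hcm) ?_ ?_
      · have : r = (u - k * m * u₀) * b + (w - k * m * w₀) * a' := by
          linear_combination hmd + hf - k * hcI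
        rw [this]; exact hlin _ _
      · rw [redTwo_degree hcm]
        exact lt_of_le_of_lt degree_map_le hlt
    obtain ⟨s, hs⟩ := (redTwo_eq_zero_iff _).1 hr0
    obtain ⟨u', w', hs'⟩ := hsat s (u - k * m * u₀) (w - k * m * w₀)
      (by linear_combination hmd + hf - k * hcI - hs)
    have hsd : redTwo c ∣ redTwo s := hs' ▸ hlin _ _
    obtain ⟨x, y, hxy⟩ := redTwo_dvd_iff.1 hsd
    have hrx : r = c * (2 * x) := by
      linear_combination hs + 2 * hxy + y * four_eq_zero_poly
    have : r = 0 := eq_zero_of_monic_dvd hcm ⟨_, hrx⟩ hlt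
    exact ⟨k, by rw [← hmd, this, zero_add]⟩
  exact ⟨c, hcm, hdiv b 1 0 (by ring), hdiv a' 0 1 (by ring), _, _, hcI⟩

/-- Two monic divisors of `x^n - 1` over `ℤ₄`, `n` odd, have a monic least common multiple, which
also has the universal property modulo `2`. -/
theorem exists_isMonicLcm {n : ℕ} (hn : Odd n) {a a' b : (ZMod 4)[X]} (ha : a.Monic)
    (hb : b.Monic) (h : a * a' = X ^ n - 1) (hdvd : b ∣ X ^ n - 1) :
    ∃ M, IsMonicLcm a b M ∧
      ∀ f, redTwo a ∣ redTwo f → redTwo b ∣ redTwo f → redTwo M ∣ redTwo f := by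
  have hco := isCoprime_of_mul_eq hn h
  obtain ⟨c, hcm, hcb, hca', u, w, hc⟩ := exists_monic_gcd hb hco (h ▸ hdvd)
  have hac : IsCoprime a c := hco.of_isCoprime_of_dvd_right hca'
  -- Here c generates (b, a'), so it plays the role of the part of b outside a. Coprimality of a and
  -- c, which persists modulo 2, gives both universal properties.
  refine ⟨a * c, ⟨ha.mul hcm, dvd_mul_right _ _, ?_, ?_⟩, ?_⟩
  · have : a * c = (a * u) * b + w * (X ^ n - 1) := by
      rw [hc, ← h]; ring
    rw [this]
    exact dvd_add (dvd_mul_left _ _) (hdvd.mul_left _)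
  · intro k hak hbk
    exact hac.mul_dvd hak (hcb.trans hbk)
  · intro f haf hbf
    rw [map_mul]
    exact (hac.map redTwo).mul_dvd haf ((map_dvd redTwo hcb).trans hbf)

/-! ### The ideals (pq, 2p) and their annihilators -/

/-- Membership in the ideal `(pq, 2p)`. -/
theorem exists_eq_iff_dvd_and_redTwo_dvd {p q f : (ZMod 4)[X]} (hp : p.Monic) :
    (∃ u w, f = u * (p * q) + w * (2 * p)) ↔ p ∣ f ∧ redTwo (p * q) ∣ redTwo f := by
  constructor
  · rintro ⟨u, w, rfl⟩
    refine ⟨⟨u * q + 2 * w, by ring⟩, redTwo u, ?_⟩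
    simp only [map_add, map_mul, redTwo_two]
    ring
  · rintro ⟨⟨m, rfl⟩, k, hk⟩
    rw [map_mul, map_mul, mul_assoc] at hk
    have := (redTwo_monic hp).isRegular.left hk
    obtain ⟨u, w, rfl⟩ := redTwo_dvd_iff.1 ⟨k, this⟩
    exact ⟨u, w, by ring⟩

/-- The annihilator of `(pq, 2p)` modulo `pqr` is `(rq, 2r)`. -/
theorem dvd_and_dvd_iff_exists_eq {p q r g : (ZMod 4)[X]} (hp : p.Monic) (hq : q.Monic)
    (hr : r.Monic) :
    (p * q * r ∣ g * (p * q) ∧ p * q * r ∣ g * (2 * p)) ↔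
      ∃ u w, g = u * (r * q) + w * (2 * r) := by
  rw [exists_eq_iff_dvd_and_redTwo_dvd hr]
  have hpq := (hp.mul hq).isRegular.left
  constructor
  · rintro ⟨⟨x, hx⟩, ⟨y, hy⟩⟩
    refine ⟨⟨x, hpq (by simp only; linear_combination hx)⟩, ?_⟩
    have h2 : 2 * g = q * r * y := hp.isRegular.left (by simp only; linear_combination hy)
    -- Modulo 2 the left side of `h2` vanishes while qr stays monic, so y = 2z; then 2(g - qrz) = 0
    -- says g ≡ qrz modulo 2.
    have hy0 : redTwo y = 0 := by
      have := congrArg redTwo h2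
      rw [map_mul, redTwo_two, zero_mul, map_mul] at this
      exact Monic.eq_zero_of_mul_eq_zero (redTwo_monic (hq.mul hr)) this.symm
    obtain ⟨z, rfl⟩ := (redTwo_eq_zero_iff _).1 hy0
    refine ⟨redTwo z, ?_⟩
    rw [← map_mul, ← sub_eq_zero, ← map_sub, ← two_mul_eq_zero_iff]
    linear_combination h2
  · rintro ⟨⟨x, rfl⟩, hd⟩
    refine ⟨⟨x, by ring⟩, ?_⟩
    obtain ⟨u, w, h⟩ := redTwo_dvd_iff.1 hd
    refine ⟨2 * u, ?_⟩
    linear_combination 2 * p * h + p * w * four_eq_zero_poly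

/-- The complement of a monic lcm of two divisors is a monic gcd of the complements. -/
theorem isMonicGcd_of_isMonicLcm {A : Type*} [CommRing A] {T a a' b b' M R : A[X]}
    (hT : T.Monic) (ha : a * a' = T) (hb : b * b' = T) (ham : a.Monic) (hbm : b.Monic)
    (hM : IsMonicLcm a b M) (hR : M * R = T) : IsMonicGcd a' b' R := by
  obtain ⟨hMm, haM, hbM, hu⟩ := hM
  refine ⟨hMm.of_mul_monic_left (hR ▸ hT), ?_, ?_, ?_⟩
  · obtain ⟨m, hm⟩ := haM
    exact ⟨m, ham.isRegular.left (by simp only; linear_combination ha - hR + R * hm)⟩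
  · obtain ⟨m, hm⟩ := hbM
    exact ⟨m, hbm.isRegular.left (by simp only; linear_combination hb - hR + R * hm)⟩
  · rintro e ⟨s, hs⟩ ⟨t, ht⟩
    -- A common divisor e need not be monic, but it divides the regular element T and can therefore
    -- be cancelled.
    have he : IsRegular e := by
      have := hT.isRegular
      rw [← ha, hs, show a * (e * s) = e * (a * s) by ring] at this
      exact (isRegular_mul_iff.1 this).1
    have hst : a * s = b * t := he.left (by
      simp only; linear_combination ha - hb - a * hs + b * ht)
    obtain ⟨m, hm⟩ := hu (a * s) ⟨s, rfl⟩ (hst ▸ ⟨t, rfl⟩)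
    exact ⟨m, hMm.isRegular.left (by simp only; linear_combination hR - ha + a * hs + e * hm)⟩

/-! ### Words and classes modulo x^n - 1 -/

section Words

variable {A : Type*} [CommRing A] {n : ℕ}

/-- The polynomial `c₀ + c₁ x + ⋯ + c_{n-1} x^{n-1}` of a word. -/
noncomputable def wordLift (c : Fin n → A) : A[X] := ∑ i : Fin n, monomial (i : ℕ) (c i)

theorem wordPoly_eq_mk (c : Fin n → A) :
    wordPoly A n c = Ideal.Quotient.mk _ (wordLift c) := wordPoly_apply A n c

theorem coeff_wordLift (c : Fin n → A) (k : ℕ) :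
    (wordLift c).coeff k = if h : k < n then c ⟨k, h⟩ else 0 := by
  simp only [wordLift, finsetSum_coeff, coeff_monomial]
  split_ifs with h
  · rw [Finset.sum_eq_single ⟨k, h⟩]
    · simp
    · intro b _ hb
      rw [if_neg]
      rintro rfl
      exact hb rfl
    · simp
  · apply Finset.sum_eq_zero
    intro i _
    rw [if_neg]
    have := i.2
    omega

theorem degree_wordLift_lt (c : Fin n → A) : (wordLift c).degree < n := by
  rw [degree_lt_iff_coeff_zero]
  intro k hk
  rw [coeff_wordLift, dif_neg (by omega)]

theorem exists_wordLift_eq {f : A[X]} (hf : f.degree < n) :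
    ∃ c : Fin n → A, wordLift c = f := by
  refine ⟨fun i => f.coeff i, ?_⟩
  ext k
  rw [coeff_wordLift]
  split_ifs with h
  · rfl
  · exact (coeff_eq_zero_of_degree_lt (lt_of_lt_of_le hf (by exact_mod_cast not_lt.1 h))).symm

theorem wordLift_injective : Function.Injective (wordLift : (Fin n → A) → A[X]) := by
  intro c d h
  ext i
  have := congrArg (fun f => coeff f (i : ℕ)) h
  simpa [coeff_wordLift] using this

theorem wordLift_add (c d : Fin n → A) : wordLift (c + d) = wordLift c + wordLift d := by
  simp [wordLift, Finset.sum_add_distrib]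

theorem wordLift_smul (a : A) (c : Fin n → A) : wordLift (a • c) = C a * wordLift c := by
  simp [wordLift, Finset.mul_sum, C_mul_monomial]

theorem map_wordLift {B : Type*} [CommRing B] (φ : A →+* B) (c : Fin n → A) :
    (wordLift c).map φ = wordLift (fun i => φ (c i)) := by
  simp [wordLift, Polynomial.map_sum]

theorem mk_eq_mk_iff_dvd {f g : A[X]} :
    (Ideal.Quotient.mk (Ideal.span {(X ^ n - 1 : A[X])}) f = Ideal.Quotient.mk _ g) ↔
      X ^ n - 1 ∣ f - g := by
  rw [Ideal.Quotient.eq, Ideal.mem_span_singleton]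

theorem mk_eq_zero_iff_dvd {f : A[X]} :
    Ideal.Quotient.mk (Ideal.span {(X ^ n - 1 : A[X])}) f = 0 ↔ X ^ n - 1 ∣ f := by
  rw [Ideal.Quotient.eq_zero_iff_mem, Ideal.mem_span_singleton]

theorem monic_X_pow_sub_one (hn : n ≠ 0) : (X ^ n - 1 : A[X]).Monic := by
  simpa using monic_X_pow_sub_C (1 : A) hn

theorem degree_X_pow_sub_one [Nontrivial A] (hn : n ≠ 0) : (X ^ n - 1 : A[X]).degree = n := by
  simpa using degree_X_pow_sub_C (Nat.pos_of_ne_zero hn) (1 : A)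

theorem wordPoly_bijective [Nontrivial A] (hn : n ≠ 0) :
    Function.Bijective (wordPoly A n) := by
  have hm := monic_X_pow_sub_one (A := A) hn
  constructor
  · rw [injective_iff_map_eq_zero]
    intro c hc
    rw [wordPoly_eq_mk, mk_eq_zero_iff_dvd] at hc
    have h0 := eq_zero_of_monic_dvd hm hc
      (by rw [degree_X_pow_sub_one hn]; exact degree_wordLift_lt c)
    apply wordLift_injective
    rw [h0]
    simp [wordLift]
  · intro z
    obtain ⟨f, rfl⟩ := Ideal.Quotient.mk_surjective z
    obtain ⟨c, hc⟩ := exists_wordLift_eq (n := n) (f := f %ₘ (X ^ n - 1))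
      (by rw [← degree_X_pow_sub_one (A := A) hn]; exact degree_modByMonic_lt f hm)
    refine ⟨c, ?_⟩
    rw [wordPoly_eq_mk, hc, mk_eq_mk_iff_dvd]
    refine ⟨- (f /ₘ (X ^ n - 1)), ?_⟩
    linear_combination modByMonic_add_div f (X ^ n - 1)

theorem mem_genCode {S : Set A[X]} {c : Fin n → A} :
    c ∈ genCode n S ↔
      wordPoly A n c ∈ Ideal.span (Ideal.Quotient.mk (Ideal.span {(X ^ n - 1 : A[X])}) '' S) :=
  Iff.rfl

theorem mk_mem_span_image {S : Set A[X]} {f : A[X]} :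
    Ideal.Quotient.mk (Ideal.span {(X ^ n - 1 : A[X])}) f ∈
        Ideal.span (Ideal.Quotient.mk (Ideal.span {(X ^ n - 1 : A[X])}) '' S) ↔
      f ∈ Ideal.span (insert (X ^ n - 1) S) := by
  rw [← Ideal.map_span, Ideal.mem_quotient_iff_mem_sup, Ideal.span_insert, sup_comm]

theorem mem_genCode_iff_wordLift {S : Set A[X]} {c : Fin n → A} :
    c ∈ genCode n S ↔ wordLift c ∈ Ideal.span (insert (X ^ n - 1) S) := by
  rw [mem_genCode, wordPoly_eq_mk, mk_mem_span_image]

/-- The generator x^n - 1 of the preimage ideal is redundant because it is a multiple of a. -/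
theorem mk_mem_span_image_pair {a b f : A[X]} (ha : a ∣ X ^ n - 1) :
    Ideal.Quotient.mk (Ideal.span {(X ^ n - 1 : A[X])}) f ∈
        Ideal.span (Ideal.Quotient.mk (Ideal.span {(X ^ n - 1 : A[X])}) '' {a, b}) ↔
      ∃ u w, f = u * a + w * b := by
  obtain ⟨a', ha'⟩ := ha
  rw [mk_mem_span_image, Ideal.mem_span_insert]
  simp only [Ideal.mem_span_pair]
  constructor
  · rintro ⟨s, _, ⟨u, w, rfl⟩, rfl⟩
    exact ⟨s * a' + u, w, by rw [ha']; ring⟩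
  · rintro ⟨u, w, rfl⟩
    exact ⟨0, _, ⟨u, w, rfl⟩, by ring⟩

theorem mem_genCode_pair {a b : A[X]} (ha : a ∣ X ^ n - 1) {c : Fin n → A} :
    c ∈ genCode n {a, b} ↔ ∃ u w, wordLift c = u * a + w * b := by
  rw [mem_genCode, wordPoly_eq_mk, mk_mem_span_image_pair ha]

/-! ### The involution x ↦ 1/x and the inner product -/

/-- The class of `x` in `A[x] / ⟨x^n - 1⟩`. -/
noncomputable def cycRoot (A : Type*) [CommRing A] (n : ℕ) : CycRing A n :=
  Ideal.Quotient.mk _ X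

theorem cycRoot_pow : cycRoot A n ^ n = 1 := by
  rw [cycRoot, ← map_pow, ← map_one (Ideal.Quotient.mk _), mk_eq_mk_iff_dvd]

theorem cycRoot_pow_mod (m : ℕ) : cycRoot A n ^ (m % n) = cycRoot A n ^ m := by
  conv_rhs => rw [← Nat.mod_add_div m n, pow_add, pow_mul, cycRoot_pow, one_pow, mul_one]

theorem aeval_cycRoot (f : A[X]) : aeval (cycRoot A n) f = Ideal.Quotient.mk _ f := by
  have : aeval (cycRoot A n) = Ideal.Quotient.mkₐ A (Ideal.span {(X ^ n - 1 : A[X])}) := by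
    apply algHom_ext
    simp [cycRoot]
  rw [this]; rfl

/-- The endomorphism `x ↦ x⁻¹ = x^{n-1}` of `A[x] / ⟨x^n - 1⟩`. -/
noncomputable def cycRev (A : Type*) [CommRing A] (n : ℕ) : CycRing A n →ₐ[A] CycRing A n :=
  Ideal.Quotient.liftₐ _ (aeval (cycRoot A n ^ (n - 1))) (by
    intro f hf
    obtain ⟨g, rfl⟩ := Ideal.mem_span_singleton.1 hf
    rw [map_mul, map_sub, map_pow, aeval_X, pow_right_comm, cycRoot_pow]
    simp)

theorem cycRev_mk (f : A[X]) :
    cycRev A n (Ideal.Quotient.mk _ f) = aeval (cycRoot A n ^ (n - 1)) f := rfl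

theorem cycRev_cycRoot : cycRev A n (cycRoot A n) = cycRoot A n ^ (n - 1) := by
  rw [cycRoot, cycRev_mk, aeval_X, cycRoot]

theorem cycRoot_mul_cycRev (hn : n ≠ 0) : cycRoot A n * cycRoot A n ^ (n - 1) = 1 := by
  rw [← pow_succ', Nat.sub_add_cancel (Nat.pos_of_ne_zero hn), cycRoot_pow]

theorem cycRev_cycRev (hn : n ≠ 0) (z : CycRing A n) : cycRev A n (cycRev A n z) = z := by
  have h1 : cycRev A n (cycRoot A n ^ (n - 1)) = cycRoot A n := by
    have h := congrArg (cycRev A n) (cycRoot_mul_cycRev (A := A) hn)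
    rw [map_mul, cycRev_cycRoot, map_one] at h
    calc _ = (cycRoot A n * cycRoot A n ^ (n - 1)) * cycRev A n (cycRoot A n ^ (n - 1)) := by
          rw [cycRoot_mul_cycRev hn, one_mul]
      _ = _ := by rw [mul_assoc, h, mul_one]
  obtain ⟨f, rfl⟩ := Ideal.Quotient.mk_surjective z
  rw [cycRev_mk, ← aeval_algHom_apply, h1, aeval_cycRoot]

theorem mk_reverse_mul_pow (hn : n ≠ 0) (f : A[X]) :
    Ideal.Quotient.mk (Ideal.span {(X ^ n - 1 : A[X])}) f.reverse *
      (cycRoot A n ^ (n - 1)) ^ f.natDegree = cycRev A n (Ideal.Quotient.mk _ f) := by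
  have h := cycRoot_mul_cycRev (A := A) hn
  -- Choosing this instance makes the inverse of x^(n-1) definitionally x, so the general evaluation
  -- formula for `reverse` applies as it stands.
  let inv : Invertible (cycRoot A n ^ (n - 1)) := ⟨cycRoot A n, h, by rw [mul_comm, h]⟩
  have := eval₂_reverse_mul_pow (algebraMap A (CycRing A n)) (cycRoot A n ^ (n - 1)) f
  rw [cycRev_mk, ← aeval_cycRoot]
  exact this

theorem wordPoly_eq_sum (c : Fin n → A) :
    wordPoly A n c = ∑ i : Fin n, c i • cycRoot A n ^ (i : ℕ) := by
  rw [wordPoly_eq_mk, ← aeval_cycRoot, wordLift, map_sum]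
  refine Finset.sum_congr rfl fun i _ => ?_
  rw [aeval_monomial]
  exact (Algebra.smul_def _ _).symm

theorem wordPoly_single (i : Fin n) :
    wordPoly A n (Pi.single i 1) = cycRoot A n ^ (i : ℕ) := by
  rw [wordPoly_eq_sum, Finset.sum_eq_single i] <;> simp +contextual

variable [Nontrivial A]

/-- The bijection between words and classes modulo `x^n - 1`. -/
noncomputable def wordEquiv (A : Type*) [CommRing A] [Nontrivial A] {n : ℕ} (hn : n ≠ 0) :
    (Fin n → A) ≃ₗ[A] CycRing A n :=
  LinearEquiv.ofBijective (wordPoly A n) (wordPoly_bijective hn)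

theorem wordEquiv_apply (hn : n ≠ 0) (c : Fin n → A) : wordEquiv A hn c = wordPoly A n c := rfl

theorem wordEquiv_symm_pow_zero (hn : n ≠ 0) (m : ℕ) :
    (wordEquiv A hn).symm (cycRoot A n ^ m) ⟨0, Nat.pos_of_ne_zero hn⟩ = if n ∣ m then 1 else 0 := by
  have hlt := Nat.mod_lt m (Nat.pos_of_ne_zero hn)
  have : (wordEquiv A hn).symm (cycRoot A n ^ m) = Pi.single ⟨m % n, hlt⟩ 1 := by
    rw [LinearEquiv.symm_apply_eq, wordEquiv_apply, wordPoly_single, cycRoot_pow_mod]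
  rw [this, Pi.single_apply]
  simp only [Fin.mk.injEq, eq_comm (a := 0), Nat.dvd_iff_mod_eq_zero]

/-- The inner product as the constant coefficient of `h(1/x) k(x)`. -/
theorem wordEquiv_symm_cycRev_mul (hn : n ≠ 0) (h k : Fin n → A) :
    (wordEquiv A hn).symm (cycRev A n (wordPoly A n h) * wordPoly A n k)
      ⟨0, Nat.pos_of_ne_zero hn⟩ = ∑ i, h i * k i := by
  rw [wordPoly_eq_sum, wordPoly_eq_sum, map_sum, Finset.sum_mul, map_sum, Finset.sum_apply]
  refine Finset.sum_congr rfl fun i _ => ?_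
  rw [Finset.mul_sum, map_sum, Finset.sum_apply, Finset.sum_eq_single i]
  all_goals simp only [map_smul, map_pow, cycRev_cycRoot, smul_mul_smul_comm, ← pow_mul, ← pow_add,
    Pi.smul_apply, wordEquiv_symm_pow_zero, smul_eq_mul]
  · rw [if_pos, mul_one]
    refine ⟨i, ?_⟩
    have := Nat.sub_add_cancel (Nat.pos_of_ne_zero hn)
    nlinarith
  · intro j _ hj
    rw [if_neg, mul_zero]
    intro hd
    apply hj
    -- The exponent (n - 1)i + j is j - i modulo n, so off-diagonal terms have no constant
    -- coefficient.
    have h1 : (n - 1) * (i : ℕ) + j + i = n * i + j := by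
      have := Nat.sub_add_cancel (Nat.pos_of_ne_zero hn)
      nlinarith
    have h2 : ((i : ℕ) : ℤ) ≡ j [ZMOD n] := by
      rw [Int.modEq_iff_dvd]
      have h3 : ((n : ℤ)) ∣ (((n - 1) * (i : ℕ) + j : ℕ) : ℤ) := by exact_mod_cast hd
      have h4 : ((j : ℕ) : ℤ) - (i : ℕ) = (((n - 1) * (i : ℕ) + j : ℕ) : ℤ) - n * (i : ℕ) := by
        have : (((n - 1) * (i : ℕ) + j : ℕ) : ℤ) + (i : ℕ) = n * (i : ℕ) + (j : ℕ) := by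
          exact_mod_cast h1
        linarith
      rw [h4]
      exact dvd_sub h3 (dvd_mul_right _ _)
    have h5 := (Int.natCast_modEq_iff.1 h2)
    exact Fin.ext (Nat.ModEq.eq_of_lt_of_lt h5 i.2 j.2).symm
  · simp

/-- Orthogonality only sees the constant coefficient of h(1/x)z. Since I is closed under
multiplication by powers of x, each coefficient of that product is the constant coefficient of
another such product, so all of them vanish. -/
theorem mem_dualCode_iff (hn : n ≠ 0) {I : Ideal (CycRing A n)} {h : Fin n → A} :
    h ∈ dualCode ((I.restrictScalars A).comap (wordPoly A n)) ↔
      ∀ z ∈ I, cycRev A n (wordPoly A n h) * z = 0 := by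
  constructor
  · intro hh z hz
    obtain ⟨c, hc⟩ := (wordPoly_bijective hn).2 (cycRev A n (wordPoly A n h) * z)
    suffices c = 0 by rw [← hc, this, map_zero]
    ext i
    have h1 : c i = ∑ j, (Pi.single i 1 : Fin n → A) j * c j := by
      simp [Pi.single_apply]
    rw [h1, ← wordEquiv_symm_cycRev_mul hn, hc, mul_left_comm]
    obtain ⟨k, hk⟩ := (wordPoly_bijective hn).2 (cycRev A n (wordPoly A n (Pi.single i 1)) * z)
    rw [← hk, wordEquiv_symm_cycRev_mul hn]
    refine hh k ?_
    show wordPoly A n k ∈ I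
    rw [hk]
    exact I.mul_mem_left _ hz
  · intro hz k hk
    rw [← wordEquiv_symm_cycRev_mul hn, hz _ hk]
    simp

end Words

/-! ### Reciprocal polynomials and the dual code -/

theorem mk_recip_eq {n : ℕ} (hn : n ≠ 0) (f : (ZMod 4)[X]) :
    ∃ u, Ideal.Quotient.mk (Ideal.span {(X ^ n - 1 : (ZMod 4)[X])}) (recip f) =
      u * cycRev (ZMod 4) n (Ideal.Quotient.mk _ f) := by
  have h := mk_reverse_mul_pow hn f
  refine ⟨Ideal.Quotient.mk _ (C ((f.coeff 0)⁻¹)) * cycRoot (ZMod 4) n ^ f.natDegree, ?_⟩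
  rw [← h, recip, map_mul]
  have h1 : cycRoot (ZMod 4) n ^ f.natDegree *
      (cycRoot (ZMod 4) n ^ (n - 1)) ^ f.natDegree = 1 := by
    rw [← mul_pow, cycRoot_mul_cycRev hn, one_pow]
  linear_combination (- Ideal.Quotient.mk (Ideal.span {(X ^ n - 1 : (ZMod 4)[X])})
    (C ((f.coeff 0)⁻¹)) * Ideal.Quotient.mk _ f.reverse) * h1

theorem cycRev_mk_eq {n : ℕ} (hn : n ≠ 0) {f : (ZMod 4)[X]} (hf : IsUnit (f.coeff 0)) :
    ∃ u, cycRev (ZMod 4) n (Ideal.Quotient.mk _ f) = u *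
      Ideal.Quotient.mk (Ideal.span {(X ^ n - 1 : (ZMod 4)[X])}) (recip f) := by
  refine ⟨Ideal.Quotient.mk _ (C (f.coeff 0)) * (cycRoot (ZMod 4) n ^ (n - 1)) ^ f.natDegree, ?_⟩
  rw [← mk_reverse_mul_pow hn f, recip, map_mul]
  have h1 : Ideal.Quotient.mk (Ideal.span {(X ^ n - 1 : (ZMod 4)[X])}) (C (f.coeff 0)) *
      Ideal.Quotient.mk _ (C ((f.coeff 0)⁻¹)) = 1 := by
    rw [← map_mul, ← C_mul, ZMod.mul_inv_of_unit _ hf, C_1, map_one]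
  linear_combination (- (cycRoot (ZMod 4) n ^ (n - 1)) ^ f.natDegree *
    Ideal.Quotient.mk _ f.reverse) * h1

/-- The constant coefficients of f and g multiply to -1. -/
theorem isUnit_coeff_zero_of_dvd {n : ℕ} (hn : n ≠ 0) {f g : (ZMod 4)[X]}
    (h : f * g = X ^ n - 1) : IsUnit (f.coeff 0) := by
  have h0 := congrArg (fun f => coeff f 0) h
  simp only [mul_coeff_zero, coeff_sub, coeff_X_pow, if_neg hn.symm, coeff_one_zero] at h0
  exact IsUnit.of_mul_eq_one (-g.coeff 0) (by linear_combination -h0)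

theorem recip_monic {f : (ZMod 4)[X]} (hf : IsUnit (f.coeff 0)) : (recip f).Monic := by
  have ht : f.reverse.leadingCoeff = f.coeff 0 := by
    rw [reverse_leadingCoeff, trailingCoeff, natTrailingDegree_eq_zero.2 (Or.inr hf.ne_zero)]
  have := monic_C_mul_of_mul_leadingCoeff_eq_one (p := f.reverse) (b := (f.coeff 0)⁻¹)
    (by rw [ht, ZMod.inv_mul_of_unit _ hf])
  exact this

theorem recip_mul {f g : (ZMod 4)[X]} (hf : f.Monic) (hg : g.Monic) (hf0 : IsUnit (f.coeff 0))
    (hg0 : IsUnit (g.coeff 0)) : recip (f * g) = recip f * recip g := by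
  have key : ∀ a b : ZMod 4, IsUnit a → IsUnit b → (a * b)⁻¹ = a⁻¹ * b⁻¹ := by
    intro a b ha hb
    have h1 := ZMod.mul_inv_of_unit _ ha
    have h2 := ZMod.mul_inv_of_unit _ hb
    have h3 := ZMod.mul_inv_of_unit _ (ha.mul hb)
    linear_combination (a⁻¹ * b⁻¹) * h3 - (a * b)⁻¹ * (b * b⁻¹) * h1 - (a * b)⁻¹ * h2
  rw [recip, reverse_mul (by rw [hf, hg]; decide), mul_coeff_zero, key _ _ hf0 hg0, C_mul, recip,
    recip]
  ring

theorem recip_X_pow_sub_one {n : ℕ} (hn : n ≠ 0) :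
    recip (X ^ n - 1 : (ZMod 4)[X]) = X ^ n - 1 := by
  have hr : (X ^ n - 1 : (ZMod 4)[X]).reverse = 1 - X ^ n := by
    have hd : (X ^ n - 1 : (ZMod 4)[X]).natDegree = n :=
      natDegree_eq_of_degree_eq_some (degree_X_pow_sub_one hn)
    rw [reverse, hd, sub_eq_add_neg, reflect_add, reflect_neg, ← C_1, reflect_C,
      ← one_mul (X ^ n), ← C_1, reflect_C_mul_X_pow]
    simp [revAt_le, sub_eq_add_neg]
  rw [recip, hr]
  have : (X ^ n - 1 : (ZMod 4)[X]).coeff 0 = -1 := by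
    simp [coeff_X_pow, hn.symm]
  rw [this, show (-1 : ZMod 4)⁻¹ = -1 by
    linear_combination -ZMod.mul_inv_of_unit (-1 : ZMod 4) isUnit_one.neg]
  simp

/-- The dual of `⟨pq, 2p⟩` is `⟨r^* q^*, 2r^*⟩`. -/
theorem dualCode_genCode {n : ℕ} (hn : n ≠ 0) {p q r : (ZMod 4)[X]} (hp : p.Monic)
    (hq : q.Monic) (hr : r.Monic) (h : p * q * r = X ^ n - 1) :
    dualCode (genCode n {p * q, 2 * p}) = genCode n {recip r * recip q, 2 * recip r} := by
  have hq0 : IsUnit (q.coeff 0) := isUnit_coeff_zero_of_dvd hn (g := p * r) (by rw [← h]; ring)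
  have hr0 : IsUnit (r.coeff 0) := isUnit_coeff_zero_of_dvd hn (g := p * q) (by rw [← h]; ring)
  ext c
  rw [genCode, mem_dualCode_iff hn, mem_genCode]
  set mk := Ideal.Quotient.mk (Ideal.span {(X ^ n - 1 : (ZMod 4)[X])}) with hmk
  have h1 : (∀ z ∈ Ideal.span (mk '' {p * q, 2 * p}),
      cycRev (ZMod 4) n (wordPoly (ZMod 4) n c) * z = 0) ↔
      cycRev (ZMod 4) n (wordPoly (ZMod 4) n c) ∈ Ideal.span (mk '' {r * q, 2 * r}) := by
    obtain ⟨g, hg⟩ := Ideal.Quotient.mk_surjective (cycRev (ZMod 4) n (wordPoly (ZMod 4) n c))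
    rw [← hg, mk_mem_span_image_pair ⟨p, by rw [← h]; ring⟩, ← dvd_and_dvd_iff_exists_eq hp hq hr,
      h, ← mk_eq_zero_iff_dvd, ← mk_eq_zero_iff_dvd, map_mul _ g (p * q), map_mul _ g (2 * p)]
    constructor
    · intro hz
      exact ⟨hz _ (Ideal.subset_span ⟨_, by simp, rfl⟩), hz _ (Ideal.subset_span ⟨_, by simp, rfl⟩)⟩
    · rintro ⟨ha, hb⟩ z hz
      rw [Set.image_pair, Ideal.mem_span_pair] at hz
      obtain ⟨u, w, rfl⟩ := hz
      linear_combination u * ha + w * hb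
  rw [h1]
  -- Up to factors in both directions, r* and q* are the images of r and q under x ↦ 1/x, so the
  -- involution carries (rq, 2r) onto (r*q*, 2r*).
  obtain ⟨u, hu⟩ := mk_recip_eq hn r
  obtain ⟨w, hw⟩ := mk_recip_eq hn q
  obtain ⟨u', hu'⟩ := cycRev_mk_eq hn hr0
  obtain ⟨w', hw'⟩ := cycRev_mk_eq hn hq0
  rw [← hmk] at hu hw hu' hw'
  simp only [Set.image_pair, Ideal.mem_span_pair, map_mul, map_ofNat, hu, hw]
  constructor
  · rintro ⟨a, b, hab⟩
    have := congrArg (cycRev (ZMod 4) n) hab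
    rw [cycRev_cycRev hn] at this
    simp only [map_add, map_mul, map_ofNat] at this
    rw [hu', hw', hu, hw] at this
    refine ⟨cycRev (ZMod 4) n a * u' * w', cycRev (ZMod 4) n b * u', ?_⟩
    rw [← this]; ring
  · rintro ⟨a, b, hab⟩
    have := congrArg (cycRev (ZMod 4) n) hab
    simp only [map_add, map_mul, map_ofNat, cycRev_cycRev hn] at this
    refine ⟨cycRev (ZMod 4) n (a * u * w), cycRev (ZMod 4) n (b * u), ?_⟩
    rw [← this]; simp only [map_mul]; ring

theorem redTwo_dvd_of_dvd {f g : (ZMod 4)[X]} (h : f ∣ g) : redTwo f ∣ redTwo g := map_dvd redTwo h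

theorem recip_mul_recip_mul_recip {n : ℕ} (hn : n ≠ 0) {p q r : (ZMod 4)[X]} (hp : p.Monic)
    (hq : q.Monic) (hr : r.Monic) (h : p * q * r = X ^ n - 1) :
    recip r * recip q * recip p = X ^ n - 1 := by
  have hp0 : IsUnit (p.coeff 0) := isUnit_coeff_zero_of_dvd hn (g := q * r) (by rw [← h]; ring)
  have hq0 : IsUnit (q.coeff 0) := isUnit_coeff_zero_of_dvd hn (g := p * r) (by rw [← h]; ring)
  have hr0 : IsUnit (r.coeff 0) := isUnit_coeff_zero_of_dvd hn (g := p * q) (by rw [← h]; ring)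
  have h' : r * q * p = X ^ n - 1 := by rw [← h]; ring
  rw [← recip_mul hr hq hr0 hq0, ← recip_mul (hr.mul hq) hp (by
    rw [mul_coeff_zero]; exact hr0.mul hq0) hp0, h', recip_X_pow_sub_one hn]

/-! ### Intersections, types and hulls over ℤ₄ -/

/-- The intersection of two codes `⟨pq, 2p⟩` and `⟨p'q', 2p'⟩`. -/
theorem exists_genCode_inf_genCode {n : ℕ} (hn : Odd n) {p q r p' q' r' : (ZMod 4)[X]}
    (hp : p.Monic) (hq : q.Monic) (hp' : p'.Monic) (hq' : q'.Monic)
    (h : p * q * r = X ^ n - 1) (h' : p' * q' * r' = X ^ n - 1) :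
    ∃ L P R Q : (ZMod 4)[X], IsMonicLcm (p * q) (p' * q') L ∧ IsMonicLcm p p' P ∧
      IsMonicGcd r r' R ∧ Q.Monic ∧ L = P * Q ∧ P * Q * R = X ^ n - 1 ∧
      genCode n {p * q, 2 * p} ⊓ genCode n {p' * q', 2 * p'} = genCode n {L, 2 * P} := by
  have hn0 : n ≠ 0 := hn.pos.ne'
  obtain ⟨L, hL, hL2⟩ := exists_isMonicLcm hn (hp.mul hq) (hp'.mul hq') h ⟨r', h'.symm⟩
  obtain ⟨P, hP, -⟩ := exists_isMonicLcm hn hp hp' (a' := q * r) (by rw [← h]; ring)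
    ⟨q' * r', by rw [← h']; ring⟩
  -- Both cofactors come from universal properties: x^n - 1 is a common multiple of pq and p'q',
  -- hence of the form LR; L is a common multiple of p and p', hence of the form PQ.
  obtain ⟨R, hR⟩ := hL.2.2.2 _ ⟨r, h.symm⟩ ⟨r', h'.symm⟩
  obtain ⟨Q, hQ⟩ := hP.2.2.2 L ((dvd_mul_right _ _).trans hL.2.1)
    ((dvd_mul_right _ _).trans hL.2.2.1)
  refine ⟨L, P, R, Q, hL, hP, isMonicGcd_of_isMonicLcm (monic_X_pow_sub_one hn0) h h' (hp.mul hq)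
    (hp'.mul hq') hL hR.symm, hP.1.of_mul_monic_left (hQ ▸ hL.1), hQ, by rw [← hQ, hR], ?_⟩
  ext c
  rw [Submodule.mem_inf, mem_genCode_pair ⟨r, h.symm⟩, mem_genCode_pair ⟨r', h'.symm⟩,
    mem_genCode_pair ⟨R, hR⟩, exists_eq_iff_dvd_and_redTwo_dvd hp,
    exists_eq_iff_dvd_and_redTwo_dvd hp', hQ, exists_eq_iff_dvd_and_redTwo_dvd hP.1, ← hQ]
  constructor
  · rintro ⟨⟨h1, h2⟩, h3, h4⟩
    exact ⟨hP.2.2.2 _ h1 h3, hL2 _ h2 h4⟩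
  · rintro ⟨h1, h2⟩
    exact ⟨⟨hP.2.1.trans h1, (redTwo_dvd_of_dvd hL.2.1).trans h2⟩, hP.2.2.1.trans h1,
      (redTwo_dvd_of_dvd hL.2.2.1).trans h2⟩

/-- Multiplication by `2` as a map `ℤ₂ → ℤ₄`. -/
def twoHom : ZMod 2 →+ ZMod 4 where
  toFun a := 2 * (a.val : ZMod 4)
  map_zero' := by decide
  map_add' := by decide

theorem wordLift_twoHom {b : ℕ} (B : Fin b → ZMod 2) :
    wordLift (fun i => twoHom (B i)) = 2 * wordLift (fun i => ((B i).val : ZMod 4)) := by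
  have := wordLift_smul (2 : ZMod 4) (fun i => ((B i).val : ZMod 4))
  rw [C_ofNat] at this
  exact this

/-- The word of `⟨pq, 2p⟩` with coordinates `(A, B)`, as a class modulo `x^n - 1`. -/
noncomputable def typeHom (n : ℕ) (p q : (ZMod 4)[X]) (a b : ℕ) :
    (Fin a → ZMod 4) × (Fin b → ZMod 2) →+ CycRing (ZMod 4) n where
  toFun AB := Ideal.Quotient.mk _
    (p * (q * wordLift AB.1 + wordLift (fun i => twoHom (AB.2 i))))
  map_zero' := by simp [wordLift]
  map_add' := by
    rintro ⟨A, B⟩ ⟨A', B'⟩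
    have : (fun i => twoHom ((B + B') i)) =
        (fun i => twoHom (B i)) + (fun i => twoHom (B' i)) := by ext i; simp
    rw [← map_add]
    congr 1
    simp only [Prod.mk_add_mk, this, wordLift_add]
    ring

/-- For monic `p, q, r` with `pqr = x^n - 1`, the code `⟨pq, 2p⟩` is of type
`4^{deg r} 2^{deg q}`. -/
theorem hasType_genCode {n : ℕ} (hn : n ≠ 0) {p q r : (ZMod 4)[X]} (hp : p.Monic)
    (hq : q.Monic) (hr : r.Monic) (h : p * q * r = X ^ n - 1) :
    HasType (genCode n {p * q, 2 * p}) r.natDegree q.natDegree := by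
  have hqd : q.degree = q.natDegree := degree_eq_natDegree hq.ne_zero
  have hrd : r.degree = r.natDegree := degree_eq_natDegree hr.ne_zero
  set F := typeHom n p q r.natDegree q.natDegree with hF
  have hinj : Function.Injective F := by
    rw [injective_iff_map_eq_zero]
    rintro ⟨A, B⟩ hAB
    have h1 : X ^ n - 1 ∣ p * (q * wordLift A + wordLift (fun i => twoHom (B i))) :=
      mk_eq_zero_iff_dvd.1 hAB
    have h2 : q * r ∣ q * wordLift A + wordLift (fun i => twoHom (B i)) := by
      obtain ⟨k, hk⟩ := h1
      exact ⟨k, hp.isRegular.left (by simp only; rw [hk, ← h]; ring)⟩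
    have hAd := degree_wordLift_lt A
    have hBd := degree_wordLift_lt (fun i => twoHom (B i))
    have h3 : q * wordLift A + wordLift (fun i => twoHom (B i)) = 0 := by
      -- Coordinates are bounded by deg r and deg q, so the sum has degree below deg(qr) and
      -- vanishes. Then q divides the second summand, which has degree below deg q and vanishes too.
      refine eq_zero_of_monic_dvd (hq.mul hr) h2 ?_
      rw [hr.degree_mul, hqd, hrd]
      refine lt_of_le_of_lt (degree_add_le _ _) (max_lt ?_ ?_)
      · rw [mul_comm, hq.degree_mul, hqd, add_comm]
        exact WithBot.add_lt_add_left (by simp) hAd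
      · exact lt_of_lt_of_le hBd (by exact_mod_cast Nat.le_add_right _ _)
    have hB0 : wordLift (fun i => twoHom (B i)) = 0 :=
      eq_zero_of_monic_dvd hq ⟨-wordLift A, by linear_combination h3⟩ (by rw [hqd]; exact hBd)
    have hA0 : wordLift A = 0 := Monic.eq_zero_of_mul_eq_zero hq (by rw [← h3, hB0, add_zero])
    have hz : ∀ m, wordLift (0 : Fin m → ZMod 4) = 0 := fun m => by simp [wordLift]
    have hA : A = 0 := wordLift_injective (by rw [hA0, hz])
    have hB : (fun i => twoHom (B i)) = 0 := wordLift_injective (by rw [hB0, hz])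
    have key : ∀ x, twoHom x = 0 → x = 0 := by decide
    refine Prod.ext hA (funext fun i => key _ (congrFun hB i))
  have hmem : ∀ x, (wordEquiv (ZMod 4) hn).symm (F x) ∈ genCode n {p * q, 2 * p} := by
    rintro ⟨A, B⟩
    rw [mem_genCode, ← wordEquiv_apply hn, LinearEquiv.apply_symm_apply]
    refine (mk_mem_span_image_pair ⟨r, h.symm⟩).2
      ⟨wordLift A, wordLift (fun i => ((B i).val : ZMod 4)), ?_⟩
    simp only [wordLift_twoHom]
    ring
  let G : (Fin r.natDegree → ZMod 4) × (Fin q.natDegree → ZMod 2) →+ genCode n {p * q, 2 * p} :=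
    { toFun := fun x => ⟨(wordEquiv (ZMod 4) hn).symm (F x), hmem x⟩
      map_zero' := by ext1; simp
      map_add' := by intro x y; ext1; simp }
  refine ⟨(AddEquiv.ofBijective G ⟨?_, ?_⟩).symm⟩
  · intro x y hxy
    exact hinj ((wordEquiv (ZMod 4) hn).symm.injective (congrArg Subtype.val hxy))
  · rintro ⟨c, hc⟩
    obtain ⟨u, v, huv⟩ := (mem_genCode_pair ⟨r, h.symm⟩).1 hc
    -- Normal form of u·pq + v·2p: reduce v modulo q, carrying the quotient into u because 2p·q =
    -- 2·pq; then reduce the new coefficient modulo r, which changes the word by a multiple of pqr =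
    -- x^n - 1.
    have hv := modByMonic_add_div v q
    have hu := modByMonic_add_div (u + 2 * (v /ₘ q)) r
    obtain ⟨A, hA⟩ := exists_wordLift_eq (n := r.natDegree)
      (f := (u + 2 * (v /ₘ q)) %ₘ r) (by rw [← hrd]; exact degree_modByMonic_lt _ hr)
    obtain ⟨B, hB⟩ := exists_wordLift_eq (n := q.natDegree)
      (f := v %ₘ q) (by rw [← hqd]; exact degree_modByMonic_lt _ hq)
    refine ⟨(A, fun i => ZMod.castHom (by norm_num : 2 ∣ 4) (ZMod 2) (B i)), ?_⟩
    apply Subtype.ext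
    show (wordEquiv (ZMod 4) hn).symm (F _) = c
    rw [LinearEquiv.symm_apply_eq, wordEquiv_apply, wordPoly_eq_mk]
    have hB2 : wordLift (fun i => twoHom (ZMod.castHom (by norm_num : 2 ∣ 4) (ZMod 2) (B i))) =
        2 * wordLift B := by
      have key : ∀ x : ZMod 4, twoHom (ZMod.castHom (by norm_num : 2 ∣ 4) (ZMod 2) x) = 2 * x := by
        decide
      simp only [key]
      have := wordLift_smul (2 : ZMod 4) B
      rw [C_ofNat] at this
      exact this
    refine mk_eq_mk_iff_dvd.2 ⟨-((u + 2 * (v /ₘ q)) /ₘ r), ?_⟩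
    simp only [hB2, hA, hB]
    rw [huv]
    linear_combination p * q * hu + 2 * p * hv - ((u + 2 * (v /ₘ q)) /ₘ r) * h

/-- The dual comes from the factorization r*q*p* = x^n - 1, so the intersection result applies with
p* as the third factor. As L = PQ, the hull has the same shape again and its type can be read off.
-/
theorem exists_hullCode_genCode {n : ℕ} (hn : Odd n) {p q r : (ZMod 4)[X]} (hp : p.Monic)
    (hq : q.Monic) (hr : r.Monic) (h : p * q * r = X ^ n - 1) :
    ∃ L P R Q : (ZMod 4)[X], IsMonicLcm (p * q) (recip r * recip q) L ∧
      IsMonicLcm p (recip r) P ∧ IsMonicGcd r (recip p) R ∧ R * P * Q = X ^ n - 1 ∧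
      hullCode (genCode n {p * q, 2 * p}) = genCode n {L, 2 * P} ∧
      HasType (genCode n {L, 2 * P}) R.natDegree Q.natDegree := by
  have hn0 : n ≠ 0 := hn.pos.ne'
  have hq0 : IsUnit (q.coeff 0) := isUnit_coeff_zero_of_dvd hn0 (g := p * r) (by rw [← h]; ring)
  have hr0 : IsUnit (r.coeff 0) := isUnit_coeff_zero_of_dvd hn0 (g := p * q) (by rw [← h]; ring)
  obtain ⟨L, P, R, Q, hL, hP, hR, hQ, hLPQ, hT, hinf⟩ := exists_genCode_inf_genCode hn hp hq
    (recip_monic hr0) (recip_monic hq0) h (recip_mul_recip_mul_recip hn0 hp hq hr h)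
  refine ⟨L, P, R, Q, hL, hP, hR, by rw [← hT]; ring, ?_, ?_⟩
  · rw [hullCode, dualCode_genCode hn0 hp hq hr h, hinf]
  · rw [hLPQ]
    exact hasType_genCode hn0 hP.1 hQ hR.1 hT

/-! ### Splitting ℤ₄ + vℤ₄ by the idempotent v -/

/-- The projection `ℤ₄ + vℤ₄ → ℤ₄` with `v ↦ 1`. -/
def Z4v.projOne : Z4v →+* ZMod 4 where
  toFun z := z.re + z.im
  map_zero' := by simp
  map_one' := by simp [QuadraticAlgebra.re_one, QuadraticAlgebra.im_one]
  map_add' x y := by simp only [QuadraticAlgebra.re_add, QuadraticAlgebra.im_add]; ring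
  map_mul' x y := by simp only [QuadraticAlgebra.re_mul, QuadraticAlgebra.im_mul]; ring

/-- The projection `ℤ₄ + vℤ₄ → ℤ₄` with `v ↦ 0`. -/
def Z4v.projZero : Z4v →+* ZMod 4 where
  toFun z := z.re
  map_zero' := by simp
  map_one' := by simp [QuadraticAlgebra.re_one]
  map_add' x y := by simp only [QuadraticAlgebra.re_add]
  map_mul' x y := by simp only [QuadraticAlgebra.re_mul]; ring

namespace Z4v

theorem projOne_v : projOne v = 1 := by simp [projOne, v]

theorem projZero_v : projZero v = 0 := by simp [projZero, v]

theorem projOne_algebraMap (a : ZMod 4) : projOne (algebraMap (ZMod 4) Z4v a) = a := by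
  simp [projOne, QuadraticAlgebra.algebraMap_eq]

theorem projZero_algebraMap (a : ZMod 4) : projZero (algebraMap (ZMod 4) Z4v a) = a := by
  simp [projZero, QuadraticAlgebra.algebraMap_eq]

theorem projOne_comp : projOne.comp (algebraMap (ZMod 4) Z4v) = RingHom.id _ :=
  RingHom.ext projOne_algebraMap

theorem projZero_comp : projZero.comp (algebraMap (ZMod 4) Z4v) = RingHom.id _ :=
  RingHom.ext projZero_algebraMap

theorem eq_combination (z : Z4v) : z = v * algebraMap (ZMod 4) Z4v (projOne z) +
    (1 - v) * algebraMap (ZMod 4) Z4v (projZero z) := by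
  conv_lhs => rw [eq_add_mul_v z]
  simp only [projOne, projZero, RingHom.coe_mk, MonoidHom.coe_mk, OneHom.coe_mk, map_add]
  ring

theorem eq_zero_iff (z : Z4v) : z = 0 ↔ projOne z = 0 ∧ projZero z = 0 := by
  constructor
  · rintro rfl
    simp
  · rintro ⟨h1, h2⟩
    rw [eq_combination z, h1, h2]
    simp

end Z4v

section VSum

variable {n : ℕ} {C₁ C₂ : Submodule (ZMod 4) (Fin n → ZMod 4)}

theorem mem_vSum_iff {c : Fin n → Z4v} :
    c ∈ vSum C₁ C₂ ↔ (fun i => Z4v.projOne (c i)) ∈ C₁ ∧ (fun i => Z4v.projZero (c i)) ∈ C₂ := by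
  constructor
  · rintro ⟨a, ha, b, hb, h⟩
    constructor
    · convert ha using 2 with i
      simp [h, Z4v.projOne_v, Z4v.projOne_algebraMap]
    · convert hb using 2 with i
      simp [h, Z4v.projZero_v, Z4v.projZero_algebraMap]
  · rintro ⟨ha, hb⟩
    exact ⟨_, ha, _, hb, fun i => Z4v.eq_combination (c i)⟩

/-- The word `v a + (1 - v) b`. -/
noncomputable def vWord (a b : Fin n → ZMod 4) : Fin n → Z4v := fun i =>
  Z4v.v * algebraMap (ZMod 4) Z4v (a i) + (1 - Z4v.v) * algebraMap (ZMod 4) Z4v (b i)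

theorem projOne_vWord (a b : Fin n → ZMod 4) (i : Fin n) : Z4v.projOne (vWord a b i) = a i := by
  simp [vWord, Z4v.projOne_v, Z4v.projOne_algebraMap]

theorem projZero_vWord (a b : Fin n → ZMod 4) (i : Fin n) : Z4v.projZero (vWord a b i) = b i := by
  simp [vWord, Z4v.projZero_v, Z4v.projZero_algebraMap]

theorem vWord_mem_vSum {a b : Fin n → ZMod 4} (ha : a ∈ C₁) (hb : b ∈ C₂) :
    vWord a b ∈ vSum C₁ C₂ := ⟨a, ha, b, hb, fun _ => rfl⟩

/-- The two projections are ring homomorphisms that jointly detect 0, so the inner product is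
computed componentwise; testing against words with one zero component separates the two conditions.
-/
theorem dualCode_vSum : dualCode (vSum C₁ C₂) = vSum (dualCode C₁) (dualCode C₂) := by
  ext c
  rw [mem_vSum_iff]
  constructor
  · intro hc
    constructor
    · intro k hk
      have := congrArg Z4v.projOne (hc _ (vWord_mem_vSum hk C₂.zero_mem))
      simpa [projOne_vWord] using this
    · intro k hk
      have := congrArg Z4v.projZero (hc _ (vWord_mem_vSum C₁.zero_mem hk))
      simpa [projZero_vWord] using this
  · rintro ⟨h1, h2⟩ k hk
    obtain ⟨hk1, hk2⟩ := mem_vSum_iff.1 hk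
    rw [Z4v.eq_zero_iff]
    simp only [map_sum, map_mul]
    exact ⟨h1 _ hk1, h2 _ hk2⟩

theorem hullCode_vSum : hullCode (vSum C₁ C₂) = vSum (hullCode C₁) (hullCode C₂) := by
  ext c
  simp only [hullCode, dualCode_vSum, Submodule.mem_inf, mem_vSum_iff]
  tauto

theorem HasType.vSum {a b a' b' : ℕ} (h₁ : HasType C₁ a b) (h₂ : HasType C₂ a' b') :
    HasType (vSum C₁ C₂) (a + a') (b + b') := by
  obtain ⟨e₁⟩ := h₁
  obtain ⟨e₂⟩ := h₂
  let e : _root_.vSum C₁ C₂ ≃+ C₁ × C₂ :=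
    { toFun := fun c => (⟨_, (mem_vSum_iff.1 c.2).1⟩, ⟨_, (mem_vSum_iff.1 c.2).2⟩)
      invFun := fun x => ⟨vWord x.1 x.2, vWord_mem_vSum x.1.2 x.2.2⟩
      left_inv := by
        rintro ⟨c, hc⟩
        ext1
        funext i
        exact (Z4v.eq_combination (c i)).symm
      right_inv := by
        rintro ⟨⟨x, hx⟩, ⟨y, hy⟩⟩
        simp only [projOne_vWord, projZero_vWord]
      map_add' := by
        rintro ⟨c, hc⟩ ⟨d, hd⟩
        ext i <;> simp }
  have split : ∀ (M : Type) [AddCommGroup M] (k l : ℕ),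
      Nonempty ((Fin k → M) × (Fin l → M) ≃+ (Fin (k + l) → M)) := fun M _ k l =>
    ⟨((LinearEquiv.funCongrLeft ℤ M finSumFinEquiv).trans
      (LinearEquiv.sumArrowLequivProdArrow (Fin k) (Fin l) ℤ M)).symm.toAddEquiv⟩
  obtain ⟨s₄⟩ := split (ZMod 4) a a'
  obtain ⟨s₂⟩ := split (ZMod 2) b b'
  exact ⟨e.trans ((e₁.prodCongr e₂).trans
    ((AddEquiv.prodProdProdComm _ _ _ _).trans (s₄.prodCongr s₂)))⟩

/-- Each projection kills two of the four generators and sends the other two to the generators over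
ℤ₄. Conversely, a polynomial is recovered from its projections as v f₁ + (1 - v) f₀. -/
theorem genCode_eq_vSum {L₁ P₁ L₂ P₂ : (ZMod 4)[X]} :
    genCode n {C Z4v.v * L₁.map (algebraMap (ZMod 4) Z4v),
        2 * C Z4v.v * P₁.map (algebraMap (ZMod 4) Z4v),
        C (1 - Z4v.v) * L₂.map (algebraMap (ZMod 4) Z4v),
        2 * C (1 - Z4v.v) * P₂.map (algebraMap (ZMod 4) Z4v)} =
      vSum (genCode n {L₁, 2 * P₁}) (genCode n {L₂, 2 * P₂}) := by
  set S : Set Z4v[X] := {C Z4v.v * L₁.map (algebraMap (ZMod 4) Z4v),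
        2 * C Z4v.v * P₁.map (algebraMap (ZMod 4) Z4v),
        C (1 - Z4v.v) * L₂.map (algebraMap (ZMod 4) Z4v),
        2 * C (1 - Z4v.v) * P₂.map (algebraMap (ZMod 4) Z4v)} with hS
  have hT : ∀ {B : Type} [CommRing B] (U : Set B[X]),
      (X ^ n - 1 : B[X]) ∈ Ideal.span (insert (X ^ n - 1) U) :=
    fun U => Ideal.subset_span (Set.mem_insert _ _)
  have hU : ∀ {B : Type} [CommRing B] {U : Set B[X]} {f : B[X]}, f ∈ U →
      f ∈ Ideal.span (insert (X ^ n - 1) U) :=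
    fun h => Ideal.subset_span (Set.mem_insert_of_mem _ h)
  ext c
  rw [mem_vSum_iff]
  simp only [mem_genCode_iff_wordLift, ← map_wordLift]
  constructor
  · intro hc
    constructor
    · have hle : Ideal.span (insert (X ^ n - 1) S) ≤
          (Ideal.span (insert (X ^ n - 1) {L₁, 2 * P₁})).comap (mapRingHom Z4v.projOne) := by
        rw [Ideal.span_le]
        rintro f (rfl | rfl | rfl | rfl | rfl) <;>
          simp only [SetLike.mem_coe, Ideal.mem_comap, coe_mapRingHom, Polynomial.map_mul,
            Polynomial.map_sub, Polynomial.map_pow, map_X, Polynomial.map_one, map_C,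
            Polynomial.map_map, Z4v.projOne_comp, Polynomial.map_id, map_sub, map_one,
            Z4v.projOne_v, sub_self, one_mul, mul_one, zero_mul, mul_zero,
            Polynomial.map_ofNat]
        · exact hT _
        · exact hU (by simp)
        · exact hU (by simp)
        · exact zero_mem _
        · exact zero_mem _
      exact hle hc
    · have hle : Ideal.span (insert (X ^ n - 1) S) ≤
          (Ideal.span (insert (X ^ n - 1) {L₂, 2 * P₂})).comap (mapRingHom Z4v.projZero) := by
        rw [Ideal.span_le]
        rintro f (rfl | rfl | rfl | rfl | rfl) <;>
          simp only [SetLike.mem_coe, Ideal.mem_comap, coe_mapRingHom, Polynomial.map_mul,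
            Polynomial.map_sub, Polynomial.map_pow, map_X, Polynomial.map_one, map_C,
            Polynomial.map_map, Z4v.projZero_comp, Polynomial.map_id, map_sub, map_one,
            Z4v.projZero_v, sub_zero, C_0, one_mul, mul_one, zero_mul, mul_zero,
            Polynomial.map_ofNat]
        · exact hT _
        · exact zero_mem _
        · exact zero_mem _
        · exact hU (by simp)
        · exact hU (by simp)
      exact hle hc
  · rintro ⟨h1, h2⟩
    -- The polynomials over ℤ₄ whose product with v lands in the big ideal form an ideal, so only
    -- generators need checking; likewise for 1 - v.
    have hle1 : Ideal.span (insert (X ^ n - 1) {L₁, 2 * P₁}) ≤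
        ((Ideal.span (insert (X ^ n - 1) S)).colon {C Z4v.v}).comap
          (mapRingHom (algebraMap (ZMod 4) Z4v)) := by
      rw [Ideal.span_le]
      rintro f (rfl | rfl | rfl) <;>
        simp only [SetLike.mem_coe, Ideal.mem_comap, coe_mapRingHom, Polynomial.map_mul,
            Polynomial.map_sub, Polynomial.map_pow, map_X, Polynomial.map_one,
            Polynomial.map_ofNat, Submodule.mem_colon_singleton, smul_eq_mul]
      · exact Ideal.mul_mem_right _ _ (hT _)
      · rw [mul_comm]; exact hU (by simp [hS])
      · rw [mul_right_comm]; exact hU (by simp [hS])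
    have hle2 : Ideal.span (insert (X ^ n - 1) {L₂, 2 * P₂}) ≤
        ((Ideal.span (insert (X ^ n - 1) S)).colon {C (1 - Z4v.v)}).comap
          (mapRingHom (algebraMap (ZMod 4) Z4v)) := by
      rw [Ideal.span_le]
      rintro f (rfl | rfl | rfl) <;>
        simp only [SetLike.mem_coe, Ideal.mem_comap, coe_mapRingHom, Polynomial.map_mul,
            Polynomial.map_sub, Polynomial.map_pow, map_X, Polynomial.map_one,
            Polynomial.map_ofNat, Submodule.mem_colon_singleton, smul_eq_mul]
      · exact Ideal.mul_mem_right _ _ (hT _)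
      · rw [mul_comm]; exact hU (by simp [hS])
      · rw [mul_right_comm]; exact hU (by simp [hS])
    have m1 := Submodule.mem_colon_singleton.1 (hle1 h1)
    have m2 := Submodule.mem_colon_singleton.1 (hle2 h2)
    have heq : wordLift c = mapRingHom (algebraMap (ZMod 4) Z4v) ((wordLift c).map Z4v.projOne) •
        C Z4v.v + mapRingHom (algebraMap (ZMod 4) Z4v) ((wordLift c).map Z4v.projZero) •
        C (1 - Z4v.v) := by
      ext1 k
      simp only [coe_mapRingHom, smul_eq_mul, coeff_add, coeff_mul_C, coeff_map]
      conv_lhs => rw [Z4v.eq_combination ((wordLift c).coeff k)]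
      ring
    rw [heq]
    exact add_mem m1 m2

end VSum

theorem theorem3p9 (n : ℕ) (hn : Odd n)
    (p₁ q₁ r₁ p₂ q₂ r₂ : (ZMod 4)[X])
    (hp₁ : p₁.Monic) (hq₁ : q₁.Monic) (hr₁ : r₁.Monic)
    (hp₂ : p₂.Monic) (hq₂ : q₂.Monic) (hr₂ : r₂.Monic)
    (h₁ : p₁ * q₁ * r₁ = X ^ n - 1) (h₂ : p₂ * q₂ * r₂ = X ^ n - 1)
    (C₁ C₂ : Submodule (ZMod 4) (Fin n → ZMod 4))
    (hC₁ : C₁ = genCode n {p₁ * q₁, 2 * p₁}) (hC₂ : C₂ = genCode n {p₂ * q₂, 2 * p₂})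
    (D : Submodule Z4v (Fin n → Z4v)) (hD : D = vSum C₁ C₂) :
    ∃ L₁ L₂ P₁ P₂ R₁ R₂ Q₁ Q₂ : (ZMod 4)[X],
      IsMonicLcm (p₁ * q₁) (recip r₁ * recip q₁) L₁ ∧
      IsMonicLcm (p₂ * q₂) (recip r₂ * recip q₂) L₂ ∧
      IsMonicLcm p₁ (recip r₁) P₁ ∧ IsMonicLcm p₂ (recip r₂) P₂ ∧
      IsMonicGcd r₁ (recip p₁) R₁ ∧ IsMonicGcd r₂ (recip p₂) R₂ ∧
      R₁ * P₁ * Q₁ = X ^ n - 1 ∧ R₂ * P₂ * Q₂ = X ^ n - 1 ∧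
      hullCode D = genCode n
        {C Z4v.v * L₁.map (algebraMap (ZMod 4) Z4v),
          2 * C Z4v.v * P₁.map (algebraMap (ZMod 4) Z4v),
          C (1 - Z4v.v) * L₂.map (algebraMap (ZMod 4) Z4v),
          2 * C (1 - Z4v.v) * P₂.map (algebraMap (ZMod 4) Z4v)} ∧
      HasType (hullCode D) (R₁.natDegree + R₂.natDegree) (Q₁.natDegree + Q₂.natDegree) := by
  obtain ⟨L₁, P₁, R₁, Q₁, hL₁, hP₁, hR₁, hT₁, hH₁, ht₁⟩ :=
    exists_hullCode_genCode hn hp₁ hq₁ hr₁ h₁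
  obtain ⟨L₂, P₂, R₂, Q₂, hL₂, hP₂, hR₂, hT₂, hH₂, ht₂⟩ :=
    exists_hullCode_genCode hn hp₂ hq₂ hr₂ h₂
  have hH : hullCode D = vSum (genCode n {L₁, 2 * P₁}) (genCode n {L₂, 2 * P₂}) := by
    rw [hD, hullCode_vSum, hC₁, hC₂, hH₁, hH₂]
  refine ⟨L₁, L₂, P₁, P₂, R₁, R₂, Q₁, Q₂, hL₁, hL₂, hP₁, hP₂, hR₁, hR₂, hT₁, hT₂, ?_, ?_⟩
  · rw [hH, genCode_eq_vSum]
  · rw [hH]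
    exact ht₁.vSum ht₂
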